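/- Let $\mu$ be the Möbius function, with the convention $\mu(0)=0$, and let $x=(\mu(n))_{n\ge 0}\in\{-1,0,1\}^{\mathbb N}$. The *Möbius flow* $(X,S)$ is the closure $X$ of the orbit of $x$ under the one-sided shift $S$; it is a compact metric space. Put $f_0(y)=y_0$, so that $\mu(n)=f_0(S^nx)$. Let $N_j\to\infty$ be a sequence of natural numbers (for instance $N_j=j$) and let $P$ be a probability measure on $X$ for which $x$ is generic along $(N_j)$, where a point $w\in X$ is called generic for $P$ along $(N_j)$ if $\frac1{N_j}\sum_{n=0}^{N_j-1}f(S^nw)\to\int f\,dP$ for every continuous $f:X\to\mathbb C$. (Measures $P$ of this kind exist, by compactness, along a suitable $(N_j)$.) For a continuous $f:X\to\mathbb C$ let $Y_n=f\circ S^n$, and let $H_\infty(f)=\bigcap_{n\ge0}\overline{\mathrm{span}}\{Y_k:k\ge n\}\subseteq L^2(P)$ be the remote space of the process $(Y_n)$. The process is *singular* (in the sense of the Wold decomposition) if $Y_0\in H_\infty(f)$. Assume: (i) $\mu$ is orthogonal to the singular dynamical processes of the Möbius flow: for every continuous $f$ such that $Y_n=f\circ S^n$ is singular, and every point $w\in X$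 that is generic for $P$ along $(N_j)$, $$\frac1{N_j}\sum_{n=1}^{N_j}Y_n(w)\,\mu(n)\longrightarrow 0 ;$$ (ii) the conditional expectation in the wide sense given the remote space of the Möbius process, i.e. the orthogonal projection of $L^2(P)$ onto $H_\infty(f_0)$, maps (classes of) continuous functions on $X$ to (classes of) continuous functions. Then $\mu$ has a spectral measure along $(N_j)$, that is, there is a finite positive measure $\sigma$ on $\mathbb R/2\pi\mathbb Z$ with $$\int e^{-ikt}\,d\sigma(t)=\lim_{j\to\infty}\frac1{N_j}\sum_{n=0}^{N_j-1}\mu(n+k)\mu(n)\qquad(k\ge 0),$$ and every such $\sigma$ is absolutely continuous with respect to Lebesgue measure, with a density $\rho$ that is positive almost everywhere and satisfies $\log\rho\in L^1$. -/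

import Mathlib

open MeasureTheory Filter Topology
open scoped ComplexConjugate

noncomputable section

/-! Spectral measures of sequences. -/

/-- The circle has positive length, so that it carries Lebesgue measure. -/
instance instFactTwoPi : Fact (0 < 2 * Real.pi) := ⟨Real.two_pi_pos⟩

/-- `σ` is the spectral measure of the sequence `g` along the averaging times `N 0, N 1, …`:
a finite positive measure on the circle with
`∫ e^{-ikx} dσ(x) = lim_j (1 / N j) ∑_{n < N j} g (n + k) * conj (g n)` for all `k ≥ 0`
(the coefficients at negative `k` are then the complex conjugates).
For `N = id` this is Wiener's spectral measure. -/
def IsSpectralMeasureAlong (N : ℕ → ℕ) (g : ℕ → ℂ) (σ : Measure (AddCircle (2 * Real.pi))) :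
    Prop :=
  IsFiniteMeasure σ ∧ ∀ k : ℕ,
    Tendsto (fun j => (N j : ℂ)⁻¹ * ∑ n ∈ Finset.range (N j), g (n + k) * conj (g n)) atTop
      (𝓝 (∫ x, fourier (-(k : ℤ)) x ∂σ))

/-- `ρ` is log-integrable with respect to `ν`. Positivity is needed since `Real.log 0 = 0`. -/
def LogIntegrable {α : Type*} [MeasurableSpace α] (ρ : α → ENNReal) (ν : Measure α) : Prop :=
  (∀ᵐ x ∂ν, 0 < ρ x) ∧ Integrable (fun x => Real.log (ρ x).toReal) ν

/-! Dynamical processes `Y n = f ∘ T ^ n` on a compact space and their Wold decomposition. -/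

section Processes

variable {X : Type*} [TopologicalSpace X]

/-- The dynamical process `Y n = f ∘ T ^ n`. -/
def dynProcess (T : C(X, X)) (f : C(X, ℂ)) (n : ℕ) : C(X, ℂ) :=
  ⟨fun x => f (T^[n] x), f.continuous.comp (T.continuous.iterate n)⟩

/-- The point `w` is generic for the measure `P` along the averaging times `N 0, N 1, …`. -/
def IsGenericAlong [MeasurableSpace X] (T : C(X, X)) (P : Measure X) (N : ℕ → ℕ) (w : X) :
    Prop :=
  ∀ f : C(X, ℂ),
    Tendsto (fun j => (N j : ℂ)⁻¹ * ∑ n ∈ Finset.range (N j), f (T^[n] w)) atTop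
      (𝓝 (∫ x, f x ∂P))

variable [CompactSpace X] [MeasurableSpace X] [BorelSpace X]

/-- The closed linear span of `Y n, Y (n + 1), Y (n + 2), …` in `L²(P)`. -/
def tailSpace (T : C(X, X)) (P : Measure X) [IsFiniteMeasure P] (f : C(X, ℂ)) (n : ℕ) :
    Submodule ℂ (Lp ℂ 2 P) :=
  (Submodule.span ℂ
    (Set.range fun k : ℕ => ContinuousMap.toLp 2 P ℂ (dynProcess T f (n + k)))).topologicalClosure

/-- The remote space of the process: the intersection of all the tail spaces. It carries the
singular part in the Wold decomposition of the isometry `g ↦ g ∘ T` on `tailSpace T P f 0`. -/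
def remoteSpace (T : C(X, X)) (P : Measure X) [IsFiniteMeasure P] (f : C(X, ℂ)) :
    Submodule ℂ (Lp ℂ 2 P) :=
  ⨅ n, tailSpace T P f n

lemma isClosed_remoteSpace (T : C(X, X)) (P : Measure X) [IsFiniteMeasure P] (f : C(X, ℂ)) :
    IsClosed (remoteSpace T P f : Set (Lp ℂ 2 P)) := by
  rw [remoteSpace, Submodule.coe_iInf]
  exact isClosed_iInter fun n => Submodule.isClosed_topologicalClosure _

instance instCompleteRemoteSpace (T : C(X, X)) (P : Measure X) [IsFiniteMeasure P]
    (f : C(X, ℂ)) : CompleteSpace (remoteSpace T P f) :=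
  (isClosed_remoteSpace T P f).completeSpace_coe

/-- The process `f ∘ T ^ n` is singular (purely linearly deterministic): it lies in its own
remote space. -/
def IsSingularProcess (T : C(X, X)) (P : Measure X) [IsFiniteMeasure P] (f : C(X, ℂ)) : Prop :=
  ContinuousMap.toLp 2 P ℂ f ∈ remoteSpace T P f

/-- The (wide-sense) conditional expectation given the remote space of the process `f ∘ T ^ n`:
the orthogonal projection of `L²(P)` onto that space. Its value at `f` is the singular part of
`f` in the Wold decomposition. -/
def remoteCondExp (T : C(X, X)) (P : Measure X) [IsFiniteMeasure P] (f : C(X, ℂ)) :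
    Lp ℂ 2 P →L[ℂ] Lp ℂ 2 P :=
  (remoteSpace T P f).starProjection

/-- The conditional expectation given the remote space of the process `f ∘ T ^ n` preserves the
space of continuous functions. -/
def CondExpPreservesContinuous (T : C(X, X)) (P : Measure X) [IsFiniteMeasure P]
    (f : C(X, ℂ)) : Prop :=
  ∀ g : C(X, ℂ), ∃ h : C(X, ℂ),
    remoteCondExp T P f (ContinuousMap.toLp 2 P ℂ g) = ContinuousMap.toLp 2 P ℂ h

/-- The Möbius function is orthogonal, along the averaging times `N 0, N 1, …`, to every singular
dynamical process of the system `(X, T, P)`, at every point that is generic for `P`. -/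
def MobiusOrthogonalToSingular (T : C(X, X)) (P : Measure X) [IsFiniteMeasure P] (N : ℕ → ℕ) :
    Prop :=
  ∀ f : C(X, ℂ), IsSingularProcess T P f → ∀ w : X, IsGenericAlong T P N w →
    Tendsto (fun j => (N j : ℂ)⁻¹ *
      ∑ n ∈ Finset.Icc 1 (N j), dynProcess T f n w * (ArithmeticFunction.moebius n : ℂ)) atTop (𝓝 0)

end Processes

/-! The Möbius flow. -/

/-- The Möbius function as a point of the one-sided sequence space (with `μ(0) = 0`). -/
def mobiusSeq : ℕ → ℤ := fun n => ArithmeticFunction.moebius n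

/-- The one-sided shift. -/
def seqShift (x : ℕ → ℤ) : ℕ → ℤ := fun n => x (n + 1)

/-- The orbit closure of the Möbius function under the one-sided shift, in the product topology. -/
def mobiusOrbitClosure : Set (ℕ → ℤ) := closure (Set.range fun k : ℕ => seqShift^[k] mobiusSeq)

lemma continuous_seqShift : Continuous seqShift :=
  continuous_pi fun n => continuous_apply (n + 1)

lemma seqShift_iterate (k : ℕ) (x : ℕ → ℤ) (n : ℕ) : seqShift^[k] x n = x (n + k) := by
  induction k generalizing x with
  | zero => rfl
  | succ k ih => rw [Function.iterate_succ_apply, ih]; exact congrArg x (by omega)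

lemma mapsTo_seqShift : Set.MapsTo seqShift mobiusOrbitClosure mobiusOrbitClosure := by
  refine Set.MapsTo.closure ?_ continuous_seqShift
  rintro _ ⟨k, rfl⟩
  exact ⟨k + 1, Function.iterate_succ_apply' _ _ _⟩

lemma isCompact_mobiusOrbitClosure : IsCompact mobiusOrbitClosure := by
  have hK : IsCompact (Set.univ.pi fun _ : ℕ => Set.Icc (-1 : ℤ) 1) :=
    isCompact_univ_pi fun _ => (Set.finite_Icc _ _).isCompact
  refine hK.of_isClosed_subset isClosed_closure (closure_minimal ?_ hK.isClosed)
  rintro _ ⟨k, rfl⟩ n -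
  simp only [seqShift_iterate]
  exact abs_le.mp ArithmeticFunction.abs_moebius_le_one

/-- The phase space of the Möbius flow. -/
abbrev MobiusFlow : Type := mobiusOrbitClosure

instance instCompactMobiusFlow : CompactSpace MobiusFlow :=
  isCompact_iff_compactSpace.mp isCompact_mobiusOrbitClosure

/-- The shift acting on the Möbius flow. -/
def mobiusShift : C(MobiusFlow, MobiusFlow) :=
  ⟨mapsTo_seqShift.restrict, continuous_seqShift.restrict mapsTo_seqShift⟩

/-- The Möbius function as a point of the Möbius flow. -/
def mobiusPoint : MobiusFlow := ⟨mobiusSeq, subset_closure ⟨0, rfl⟩⟩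

/-- The zeroth coordinate, a continuous function `f` on the Möbius flow with
`μ(n) = f (S ^ n x)` at the point `x = mobiusPoint`. -/
def mobiusCoord : C(MobiusFlow, ℂ) :=
  ⟨fun x => ((x.1 0 : ℤ) : ℂ),
    (continuous_of_discreteTopology (f := fun m : ℤ => (m : ℂ))).comp
      ((continuous_apply 0).comp continuous_subtype_val)⟩

end

/-! Telescoping along the orbit of $x$ shows that $P$ is $S$-invariant, so $U g=g\circ S$ is an
isometry of $L^2(P)$, and genericity identifies the $k$-th correlation of $\mu$ with $\langle
f_0,U^kf_0\rangle$. The spectral measure is thus that of the vector $f_0$.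

Let $s$ be the projection of $f_0$ onto its remote space. By (ii), $s$ is the class of a continuous
$h$. Since $U$ maps the remote space onto itself, the projection commutes with $U$, and hence $h$ is
singular. Then (i) at the point $x$ gives $\langle f_0,s\rangle=0$. But $\langle
f_0,s\rangle=\|s\|^2$, so $s=0$ and the remote space is trivial (`remote_mobiusCoord_eq_bot`).
Moreover $f_0\ne0$, because squarefree numbers have positive lower density.

A nonzero vector with trivial remote space is a moving average $\sum a_kU^ke$ of orthonormal
innovations with $a_0\ne0$ (`Wold.exists_innovation`). Its spectral density is therefore
$|\varphi|^2$ with $\varphi=\sum\overline{a_k}e^{ikt}$ in the Hardy space $H^2$. Jensen's inequality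
for the partial sums, followed by Fatou's lemma, gives $\log|\varphi|\in L^1$
(`log_integrable_of_tendsto_toLp`). Uniqueness of Fourier coefficients extends the conclusion to
every $\sigma$. -/

noncomputable section

/-! Wold decomposition of an isometry on a Hilbert space, along the orbit of a vector. -/

namespace Wold

variable {H : Type*} [NormedAddCommGroup H] [InnerProductSpace ℂ H]

/-- The closed linear span of `U ^ n f, U ^ (n + 1) f, …`. -/
def tail (U : H →ₗᵢ[ℂ] H) (f : H) (n : ℕ) : Submodule ℂ H :=
  (Submodule.span ℂ (Set.range fun k : ℕ => U^[n + k] f)).topologicalClosure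

/-- The intersection of the closed spans of the tails of the orbit of `f`. -/
def remote (U : H →ₗᵢ[ℂ] H) (f : H) : Submodule ℂ H := ⨅ n, tail U f n

variable (U : H →ₗᵢ[ℂ] H) (f : H)

lemma iterate_mem_tail {n m : ℕ} (h : n ≤ m) : U^[m] f ∈ tail U f n := by
  obtain ⟨k, rfl⟩ := Nat.exists_eq_add_of_le h
  exact Submodule.le_topologicalClosure _ (Submodule.subset_span ⟨k, rfl⟩)

lemma isClosed_tail (n : ℕ) : IsClosed (tail U f n : Set H) :=
  Submodule.isClosed_topologicalClosure _

variable {U f} in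
lemma tail_le {n : ℕ} {K : Submodule ℂ H} (hK : IsClosed (K : Set H))
    (h : ∀ m, n ≤ m → U^[m] f ∈ K) : tail U f n ≤ K := by
  refine Submodule.topologicalClosure_minimal _ (Submodule.span_le.2 ?_) hK
  rintro _ ⟨k, rfl⟩
  exact h _ (Nat.le_add_right _ _)

lemma tail_antitone : Antitone (tail U f) := fun _ _ hnm =>
  tail_le (isClosed_tail U f _) fun _ hk => iterate_mem_tail U f (hnm.trans hk)

lemma remote_le_tail (n : ℕ) : remote U f ≤ tail U f n := iInf_le _ n

lemma isClosed_remote : IsClosed (remote U f : Set H) := by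
  rw [remote, Submodule.coe_iInf]
  exact isClosed_iInter fun n => isClosed_tail U f n

lemma map_mem_tail_succ {n : ℕ} {x : H} (hx : x ∈ tail U f n) : U x ∈ tail U f (n + 1) := by
  have h : tail U f n ≤ (tail U f (n + 1)).comap U.toLinearMap := by
    refine tail_le ((isClosed_tail U f _).preimage U.continuous) fun m hm => ?_
    change U (U^[m] f) ∈ tail U f (n + 1)
    rw [← Function.iterate_succ_apply' U]
    exact iterate_mem_tail U f (by omega)
  exact h hx

lemma iterate_map_mem_tail {n : ℕ} {x : H} (hx : x ∈ tail U f n) (k : ℕ) :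
    U^[k] x ∈ tail U f (n + k) := by
  induction k with
  | zero => exact hx
  | succ k ih => rw [Function.iterate_succ_apply']; exact map_mem_tail_succ U f ih

lemma map_mem_remote {x : H} (hx : x ∈ remote U f) : U x ∈ remote U f := by
  rw [remote, Submodule.mem_iInf] at hx ⊢
  exact fun n => tail_antitone U f n.le_succ (map_mem_tail_succ U f (hx n))

/-- If $f$ were predictable from its strict future, applying $U^m$ would make every tail equal to
the next one, so $f$ would lie in all of them. -/
lemma not_mem_tail_one (hf : f ≠ 0) (h : remote U f = ⊥) : f ∉ tail U f 1 := by
  intro h1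
  have key : ∀ n, f ∈ tail U f n := by
    intro n
    induction n with
    | zero => exact iterate_mem_tail U f le_rfl
    | succ n ih =>
      refine tail_le (isClosed_tail U f (n + 1)) (n := n) (fun m hm => ?_) ih
      exact tail_antitone U f (by omega) (iterate_map_mem_tail U f h1 m)
  have : f ∈ remote U f := (Submodule.mem_iInf _).2 key
  rw [h] at this
  exact hf this

variable [CompleteSpace H]

lemma tail_succ_le_map (n : ℕ) : tail U f (n + 1) ≤ (tail U f n).map U.toLinearMap := by
  refine tail_le ?_ fun m hm => ?_
  · exact U.isometry.isClosedEmbedding.isClosedMap _ (isClosed_tail U f n)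
  · obtain ⟨k, rfl⟩ := Nat.exists_eq_add_of_le' (Nat.le_of_add_left_le hm)
    refine ⟨U^[k] f, iterate_mem_tail U f (by omega), ?_⟩
    rw [Function.iterate_succ_apply']
    rfl

/-- Each tail supplies a preimage of $x$; injectivity of $U$ makes these preimages coincide. So $U$
is onto on the remote space, which makes its orthogonal complement invariant too. -/
lemma exists_mem_remote_map_eq {x : H} (hx : x ∈ remote U f) : ∃ y ∈ remote U f, U y = x := by
  have h : ∀ n, ∃ y ∈ tail U f n, U y = x := fun n =>
    tail_succ_le_map U f n (remote_le_tail U f (n + 1) hx)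
  choose y hy hyx using h
  refine ⟨y 0, (Submodule.mem_iInf _).2 fun n => ?_, hyx 0⟩
  rw [U.injective ((hyx 0).trans (hyx n).symm)]
  exact hy n

lemma map_mem_remote_orthogonal {x : H} (hx : x ∈ (remote U f)ᗮ) : U x ∈ (remote U f)ᗮ := by
  rw [Submodule.mem_orthogonal] at hx ⊢
  intro y hy
  obtain ⟨z, hz, rfl⟩ := exists_mem_remote_map_eq U f hy
  rw [U.inner_map_map]
  exact hx z hz

instance : CompleteSpace (remote U f) := (isClosed_remote U f).completeSpace_coe

instance (n : ℕ) : CompleteSpace (tail U f n) := (isClosed_tail U f n).completeSpace_coe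

lemma starProjection_remote_map (x : H) :
    (remote U f).starProjection (U x) = U ((remote U f).starProjection x) := by
  refine Submodule.eq_starProjection_of_mem_orthogonal
    (map_mem_remote U f (Submodule.starProjection_apply_mem _ _)) ?_
  rw [← map_sub]
  exact map_mem_remote_orthogonal U f (Submodule.sub_starProjection_mem_orthogonal x)

lemma starProjection_remote_iterate (x : H) (n : ℕ) :
    (remote U f).starProjection (U^[n] x) = U^[n] ((remote U f).starProjection x) := by
  induction n with
  | zero => rfl
  | succ n ih => rw [Function.iterate_succ_apply', Function.iterate_succ_apply',
      starProjection_remote_map, ih]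

/-- The singular part of a vector is singular. -/
lemma starProjection_mem_remote :
    (remote U f).starProjection f ∈ remote U ((remote U f).starProjection f) := by
  set s := (remote U f).starProjection f with hs
  have hsR : s ∈ remote U f := Submodule.starProjection_apply_mem _ _
  refine (Submodule.mem_iInf _).2 fun n => ?_
  -- The projection commutes with $U$, so it carries the tails of $f$ into those of $s$; it fixes
  -- $s$, which lies in every tail of $f$.
  have h : tail U f n ≤ (tail U s n).comap (remote U f).starProjection.toLinearMap := by
    refine tail_le ((isClosed_tail U s n).preimage (remote U f).starProjection.continuous)
      fun m hm => ?_
    change (remote U f).starProjection (U^[m] f) ∈ tail U s n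
    rw [starProjection_remote_iterate]
    exact iterate_mem_tail U s hm
  have := h (remote_le_tail U f n hsR)
  change (remote U f).starProjection s ∈ tail U s n at this
  rwa [Submodule.starProjection_eq_self_iff.2 hsR] at this

/-- The whole orbit projects to zero, so the tail space at $0$ is orthogonal to the remote space it
contains. -/
lemma remote_eq_bot_of_starProjection_eq_zero (h : (remote U f).starProjection f = 0) :
    remote U f = ⊥ := by
  have h1 : tail U f 0 ≤ (remote U f)ᗮ := by
    refine tail_le (Submodule.isClosed_orthogonal _) fun m _ => ?_
    have := starProjection_remote_iterate U f f m
    rw [h, ← LinearIsometry.coe_pow, map_zero] at this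
    rw [← LinearIsometry.coe_pow]
    exact (Submodule.starProjection_apply_eq_zero_iff _).1 this
  exact (Submodule.isOrtho_self.1 ((Submodule.isOrtho_iff_le.2 ((remote_le_tail U f 0).trans h1))))

/-- If a vector is orthogonal to its singular part, its remote space is trivial. -/
lemma remote_eq_bot_of_inner_eq_zero (h : inner ℂ f ((remote U f).starProjection f) = 0) :
    remote U f = ⊥ := by
  refine remote_eq_bot_of_starProjection_eq_zero U f ?_
  rw [← inner_self_eq_zero (𝕜 := ℂ), Submodule.inner_starProjection_left_eq_right,
    Submodule.starProjection_eq_self_iff.2 (Submodule.starProjection_apply_mem _ _)]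
  exact h

/-- The complements of the tails increase, and their union is dense because the tails intersect
trivially. -/
lemma tendsto_sub_starProjection_tail (h : remote U f = ⊥) (x : H) :
    Tendsto (fun n => x - (tail U f n).starProjection x) atTop (𝓝 x) := by
  have := Submodule.starProjection_tendsto_self (fun n => (tail U f n)ᗮ)
    (fun n m hnm => Submodule.orthogonal_le (tail_antitone U f hnm)) x ?_
  · simpa [Submodule.starProjection_orthogonal] using this
  · refine top_le_iff.2 ((Submodule.topologicalClosure_eq_top_iff).2 ?_)
    rw [← Submodule.iInf_orthogonal, ← h, remote]
    refine iInf_congr fun n => ?_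
    rw [Submodule.orthogonal_orthogonal]

/-- A nonzero vector with trivial remote space is a one-sided moving average of the orbit of a unit
innovation vector. -/
theorem exists_innovation (hf : f ≠ 0) (h : remote U f = ⊥) :
    ∃ e : H, Orthonormal ℂ (fun n : ℕ => U^[n] e) ∧ inner ℂ e f ≠ 0 ∧
      Tendsto (fun n => ∑ k ∈ Finset.range n, inner ℂ (U^[k] e) f • U^[k] e) atTop (𝓝 f) := by
  -- The one-step prediction error; normalized, it is the innovation $e$.
  set d := f - (tail U f 1).starProjection f with hd
  have hd1 : d ∈ (tail U f 1)ᗮ := Submodule.sub_starProjection_mem_orthogonal f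
  have hd0 : d ≠ 0 := fun h0 => not_mem_tail_one U f hf h <|
    Submodule.starProjection_eq_self_iff.1 (sub_eq_zero.1 h0).symm
  have hdf : inner ℂ d f = inner ℂ d d := by
    have h0 : inner ℂ d ((tail U f 1).starProjection f) = 0 :=
      Submodule.inner_left_of_mem_orthogonal (Submodule.starProjection_apply_mem _ _) hd1
    have h1 : inner ℂ d d = inner ℂ d f - inner ℂ d ((tail U f 1).starProjection f) := by
      rw [← inner_sub_right]
    rw [h1, h0, sub_zero]
  have hnd : (‖d‖ : ℂ) ≠ 0 := by exact_mod_cast norm_ne_zero_iff.2 hd0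
  set e : H := ((‖d‖ : ℂ)⁻¹) • d with he
  have he1 : e ∈ (tail U f 1)ᗮ := Submodule.smul_mem _ _ hd1
  have hde : d = (‖d‖ : ℂ) • e := by rw [he, smul_inv_smul₀ hnd]
  have hne : ‖e‖ = 1 := by
    rw [he, norm_smul, norm_inv, Complex.norm_real, norm_norm,
      inv_mul_cancel₀ (norm_ne_zero_iff.2 hd0)]
  have hef : inner ℂ e f = (‖d‖ : ℂ) := by
    rw [he, inner_smul_left, hdf, inner_self_eq_norm_sq_to_K]
    simp
    field_simp
  have hfe : f - inner ℂ e f • e ∈ tail U f 1 := by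
    rw [hef, ← hde, hd, sub_sub_cancel]
    exact Submodule.starProjection_apply_mem _ _
  have heT : e ∈ tail U f 0 := by
    refine Submodule.smul_mem _ _ (Submodule.sub_mem _ (iterate_mem_tail U f le_rfl) ?_)
    exact tail_antitone U f zero_le_one (Submodule.starProjection_apply_mem _ _)
  have hinner : ∀ (n : ℕ) (x y : H), inner ℂ (U^[n] x) (U^[n] y) = inner ℂ x y := fun n x y => by
    rw [← LinearIsometry.coe_pow, LinearIsometry.inner_map_map]
  have horth : ∀ n, U^[n] e ∈ (tail U f (n + 1))ᗮ := by
    intro n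
    rw [Submodule.mem_orthogonal']
    have : tail U f (n + 1) ≤ (Submodule.span ℂ {U^[n] e})ᗮ := by
      refine tail_le (Submodule.isClosed_orthogonal _) fun m hm => ?_
      rw [Submodule.mem_orthogonal_singleton_iff_inner_right]
      obtain ⟨k, rfl⟩ := Nat.exists_eq_add_of_le hm
      rw [add_assoc, Function.iterate_add_apply, hinner]
      exact Submodule.inner_left_of_mem_orthogonal (iterate_mem_tail U f (by omega)) he1
    exact fun u hu => (Submodule.mem_orthogonal_singleton_iff_inner_right).1 (this hu)
  have hmem : ∀ n, U^[n] e ∈ tail U f n := fun n => by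
    simpa using iterate_map_mem_tail U f heT n
  have hlt : ∀ i j, i < j → inner ℂ (U^[i] e) (U^[j] e) = 0 := fun i j hij =>
    Submodule.inner_left_of_mem_orthogonal (tail_antitone U f hij (hmem j)) (horth i)
  have hon : Orthonormal ℂ (fun n : ℕ => U^[n] e) := by
    refine ⟨fun n => ?_, fun i j hij => ?_⟩
    · change ‖U^[n] e‖ = 1
      rw [← LinearIsometry.coe_pow, LinearIsometry.norm_map, hne]
    · rcases lt_or_gt_of_ne hij with hij | hij
      · exact hlt i j hij
      · exact inner_eq_zero_symm.1 (hlt j i hij)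
  -- Removing the component along $U^ne$ pushes tail $n$ into tail $n+1$. On generators: for $m=n$
  -- this is $U^n$ applied to `hfe`, and for $m>n$ the component is zero.
  have hstep : ∀ n x, x ∈ tail U f n → x - inner ℂ (U^[n] e) x • U^[n] e ∈ tail U f (n + 1) := by
    intro n
    let L : H →L[ℂ] H := ContinuousLinearMap.id ℂ H -
      (innerSL ℂ (U^[n] e)).smulRight (U^[n] e)
    have : tail U f n ≤ (tail U f (n + 1)).comap L.toLinearMap := by
      refine tail_le ((isClosed_tail U f (n + 1)).preimage L.continuous) fun m hm => ?_
      change U^[m] f - inner ℂ (U^[n] e) (U^[m] f) • U^[n] e ∈ tail U f (n + 1)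
      rcases hm.eq_or_lt with rfl | hm
      · rw [hinner, ← LinearIsometry.coe_pow, ← map_smul, ← map_sub, LinearIsometry.coe_pow,
          add_comm n 1]
        exact iterate_map_mem_tail U f hfe n
      · rw [Submodule.inner_left_of_mem_orthogonal (iterate_mem_tail U f hm) (horth n), zero_smul,
          sub_zero]
        exact iterate_mem_tail U f hm
    exact fun x hx => this hx
  refine ⟨e, hon, by rw [hef]; exact hnd, ?_⟩
  have hrest : ∀ n, f - ∑ k ∈ Finset.range n, inner ℂ (U^[k] e) f • U^[k] e ∈ tail U f n := by
    intro n
    induction n with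
    | zero => simpa using iterate_mem_tail U f (le_refl 0)
    | succ n ih =>
      have := hstep n _ ih
      have hz : ∑ k ∈ Finset.range n, inner ℂ (U^[n] e) (inner ℂ (U^[k] e) f • U^[k] e) = 0 := by
        refine Finset.sum_eq_zero fun k hk => ?_
        rw [inner_smul_right, hon.2 (Finset.mem_range.1 hk).ne', mul_zero]
      rw [inner_sub_right, inner_sum, hz, sub_zero, sub_sub, ← Finset.sum_range_succ] at this
      exact this
  -- The remainder lies in tail $n$ and the partial sum is orthogonal to it, so the partial sum is
  -- exactly $f$ minus its projection.
  refine (tendsto_sub_starProjection_tail U f h f).congr fun n => ?_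
  rw [Submodule.eq_starProjection_of_mem_orthogonal (hrest n) ?_, sub_sub_cancel]
  rw [sub_sub_cancel]
  refine Submodule.sum_mem _ fun k hk => Submodule.smul_mem _ _ ?_
  exact Submodule.orthogonal_le (tail_antitone U f (Finset.mem_range.1 hk)) (horth k)

end Wold

section

/-! Jensen's inequality and log-integrability of boundary values. -/

open AddCircle Polynomial

lemma toAddCircle_apply_coe (p : ℂ[X]) (t : ℝ) :
    p.toAddCircle (t : AddCircle (2 * Real.pi)) = p.eval (circleMap 0 1 t) := by
  simp [toAddCircle, toCircle, circleMap]

lemma integrable_log_norm_toAddCircle (p : ℂ[X]) :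
    Integrable (fun x => Real.log ‖p.toAddCircle x‖) (haarAddCircle (T := 2 * Real.pi)) := by
  have hv : Integrable (fun x => Real.log ‖p.toAddCircle x‖)
      (volume : Measure (AddCircle (2 * Real.pi))) := by
    have hm : AEStronglyMeasurable (fun x => Real.log ‖p.toAddCircle x‖)
        (volume : Measure (AddCircle (2 * Real.pi))) :=
      (Real.measurable_log.comp p.toAddCircle.continuous.norm.measurable).aestronglyMeasurable
    rw [← (AddCircle.measurePreserving_mk (2 * Real.pi) 0).integrable_comp hm]
    have := (intervalIntegrable_iff_integrableOn_Ioc_of_le Real.two_pi_pos.le).1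
      (intervalIntegrable_mahlerMeasure p)
    rw [zero_add]
    refine Integrable.congr this (Eventually.of_forall fun t => ?_)
    simp only [Function.comp_apply]
    rw [toAddCircle_apply_coe]
  rw [volume_eq_smul_haarAddCircle] at hv
  exact (integrable_smul_measure (by simp [Real.pi_pos]) ENNReal.ofReal_ne_top).1 hv

/-- Jensen's inequality for polynomials on the unit circle. -/
lemma log_norm_coeff_zero_le_integral (p : ℂ[X]) (hp : p.coeff 0 ≠ 0) :
    Real.log ‖p.coeff 0‖ ≤
      ∫ x, Real.log ‖p.toAddCircle x‖ ∂(haarAddCircle (T := 2 * Real.pi)) := by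
  have hp0 : p ≠ 0 := by rintro rfl; simp at hp
  -- For the constant coefficient the binomial factor is $1$, and the bound by the Mahler measure is
  -- Jensen's inequality.
  have h := norm_coeff_le_choose_mul_mahlerMeasure 0 p
  rw [Nat.choose_zero_right, Nat.cast_one, one_mul] at h
  have h2 := Real.log_le_log (norm_pos_iff.2 hp) h
  rw [mahlerMeasure_def_of_ne_zero hp0, Real.log_exp] at h2
  refine h2.trans_eq ?_
  rw [integral_haarAddCircle, ← AddCircle.intervalIntegral_preimage (2 * Real.pi) 0, zero_add,
    smul_eq_mul]
  simp only [toAddCircle_apply_coe]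

lemma haarAddCircle_singleton (x : AddCircle (2 * Real.pi)) :
    haarAddCircle ({x} : Set (AddCircle (2 * Real.pi))) = 0 := by
  have h := AddCircle.volume_closedBall (2 * Real.pi) (x := x) 0
  rw [Metric.closedBall_zero, mul_zero, min_eq_right Real.two_pi_pos.le, ENNReal.ofReal_zero,
    volume_eq_smul_haarAddCircle, Measure.smul_apply, smul_eq_mul, mul_eq_zero] at h
  exact h.resolve_left (by simp [Real.pi_pos])

lemma ae_toAddCircle_ne_zero (p : ℂ[X]) (hp : p ≠ 0) :
    ∀ᵐ x ∂(haarAddCircle (T := 2 * Real.pi)), p.toAddCircle x ≠ 0 := by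
  have hfin : {x : AddCircle (2 * Real.pi) | p.toAddCircle x = 0}.Finite := by
    have h1 : ((fun x : AddCircle (2 * Real.pi) => (toCircle x : ℂ)) ⁻¹'
        (p.roots.toFinset : Set ℂ)).Finite := by
      refine Set.Finite.preimage ?_ (Finset.finite_toSet _)
      exact (Subtype.val_injective.comp (injective_toCircle Real.two_pi_pos.ne')).injOn
    refine h1.subset fun x hx => ?_
    induction x using QuotientAddGroup.induction_on with
    | H t =>
      have hx' : p.toAddCircle (t : AddCircle (2 * Real.pi)) = 0 := hx
      rw [toAddCircle_apply_coe] at hx'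
      simpa [hp, toCircle, circleMap] using hx'
  rw [ae_iff]
  simp only [not_not]
  rw [← Set.biUnion_of_singleton {x | p.toAddCircle x = 0}]
  exact (measure_biUnion_null_iff hfin.countable).2 fun x _ => haarAddCircle_singleton x

/-- An `L²` limit of polynomials with a fixed nonzero constant coefficient is log-integrable. -/
theorem log_integrable_of_tendsto_toLp {q : ℕ → ℂ[X]} {c : ℂ} (hc : c ≠ 0)
    (hq : ∀ n, (q n).coeff 0 = c) {φ : Lp ℂ 2 (haarAddCircle (T := 2 * Real.pi))}
    (h : Tendsto (fun n => ContinuousMap.toLp 2 haarAddCircle ℂ (q n).toAddCircle) atTop (𝓝 φ)) :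
    (∀ᵐ x ∂haarAddCircle, φ x ≠ 0) ∧ Integrable (fun x => Real.log ‖φ x‖) haarAddCircle := by
  have hq0 : ∀ n, q n ≠ 0 := fun n h0 => hc (by rw [← hq n, h0, coeff_zero])
  have hcoe : ∀ n, (ContinuousMap.toLp 2 haarAddCircle ℂ (q n).toAddCircle :
      AddCircle (2 * Real.pi) → ℂ) =ᵐ[haarAddCircle] (q n).toAddCircle := fun n =>
    ContinuousMap.coeFn_toLp haarAddCircle _
  obtain ⟨ns, -, hns⟩ := (tendstoInMeasure_of_tendsto_Lp h).exists_seq_tendsto_ae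
  obtain ⟨C, hC⟩ : ∃ C : ℝ, ∀ n,
      ‖ContinuousMap.toLp 2 haarAddCircle ℂ (q n).toAddCircle‖ ^ 2 ≤ C := by
    obtain ⟨C, hC⟩ := ((h.norm.pow 2).bddAbove_range)
    exact ⟨C, fun n => hC ⟨n, rfl⟩⟩
  -- Nonnegative since $\log t\le t-1\le t^2$, so Fatou applies; Jensen and the bounded $L^2$ norms
  -- control its integrals.
  let u : ℂ → ℝ := fun z => ‖z‖ ^ 2 - Real.log ‖z‖
  have hu0 : ∀ z, 0 ≤ u z := by
    intro z
    rcases eq_or_ne z 0 with rfl | hz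
    · simp [u]
    · have := Real.log_le_sub_one_of_pos (norm_pos_iff.2 hz)
      simp only [u]
      nlinarith [sq_nonneg (‖z‖ - 1)]
  have humeas : Measurable u :=
    (measurable_norm.pow_const 2).sub (Real.measurable_log.comp measurable_norm)
  have hsq : ∀ n, Integrable (fun x => ‖(q n).toAddCircle x‖ ^ 2) haarAddCircle := fun n => by
    have h1 := ((memLp_two_iff_integrable_sq_norm (Lp.aestronglyMeasurable _)).1
      (Lp.memLp (ContinuousMap.toLp 2 haarAddCircle ℂ (q n).toAddCircle)))
    refine h1.congr ?_
    filter_upwards [hcoe n] with x hx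
    rw [hx]
  have hbound : ∀ n, ∫⁻ x, ENNReal.ofReal (u ((q n).toAddCircle x)) ∂haarAddCircle ≤
      ENNReal.ofReal (C - Real.log ‖c‖) := by
    intro n
    refine (ofReal_integral_eq_lintegral_ofReal
      ((hsq n).sub (integrable_log_norm_toAddCircle _))
      (Eventually.of_forall fun x => hu0 _)).symm.trans_le ?_
    refine ENNReal.ofReal_le_ofReal ?_
    simp only [Pi.sub_apply]
    rw [integral_sub (hsq n) (integrable_log_norm_toAddCircle _)]
    have h1 := log_norm_coeff_zero_le_integral (q n) (by rw [hq]; exact hc)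
    rw [hq] at h1
    have h2 : ∫ x, ‖(q n).toAddCircle x‖ ^ 2 ∂haarAddCircle =
        ‖ContinuousMap.toLp 2 haarAddCircle ℂ (q n).toAddCircle‖ ^ 2 := by
      have h3 := inner_self_eq_norm_sq_to_K (𝕜 := ℂ)
        (ContinuousMap.toLp 2 haarAddCircle ℂ (q n).toAddCircle)
      rw [ContinuousMap.inner_toLp] at h3
      simp only [Complex.mul_conj', ← Complex.ofReal_pow, integral_complex_ofReal] at h3
      exact Complex.ofReal_injective (h3.trans (by simp))
    rw [h2]
    linarith [hC n]
  have hfatou : ∫⁻ x, liminf (fun i => ENNReal.ofReal (u ((q (ns i)).toAddCircle x))) atTop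
      ∂haarAddCircle ≤ ENNReal.ofReal (C - Real.log ‖c‖) := by
    refine (lintegral_liminf_le fun i =>
      (humeas.comp (q (ns i)).toAddCircle.continuous.measurable).ennreal_ofReal).trans ?_
    exact (liminf_le_liminf (Eventually.of_forall fun i => hbound (ns i))).trans_eq
      (liminf_const _)
  have hconv : ∀ᵐ x ∂haarAddCircle, (∀ n, (q n).toAddCircle x ≠ 0) ∧
      Tendsto (fun i => (q (ns i)).toAddCircle x) atTop (𝓝 (φ x)) := by
    filter_upwards [ae_all_iff.2 fun n => ae_toAddCircle_ne_zero (q n) (hq0 n),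
      ae_all_iff.2 hcoe, hns] with x hx1 hx2 hx3
    exact ⟨hx1, hx3.congr fun i => hx2 _⟩
  -- Since `Real.log 0 = 0`, $u$ does not blow up at $0$ itself. It does along nonzero values
  -- tending to $0$, hence the need for $q_n(x)\ne0$ almost everywhere.
  have hne : ∀ᵐ x ∂haarAddCircle, φ x ≠ 0 := by
    have hlt := ae_lt_top (μ := haarAddCircle) (.liminf fun i =>
      (humeas.comp (q (ns i)).toAddCircle.continuous.measurable).ennreal_ofReal)
      (hfatou.trans_lt ENNReal.ofReal_lt_top).ne
    filter_upwards [hlt, hconv] with x hx ⟨hx1, hx2⟩ h0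
    refine hx.ne ?_
    refine Tendsto.liminf_eq ?_
    refine ENNReal.tendsto_ofReal_nhds_top.2 ?_
    rw [h0] at hx2
    have h1 : Tendsto (fun i => ‖(q (ns i)).toAddCircle x‖) atTop (𝓝[≠] 0) :=
      tendsto_nhdsWithin_iff.2 ⟨by simpa using hx2.norm,
        Eventually.of_forall fun i => norm_ne_zero_iff.2 (hx1 _)⟩
    have h2 := tendsto_neg_atBot_atTop.comp (Real.tendsto_log_nhdsNE_zero.comp h1)
    exact tendsto_atTop_mono (fun i => by simp [u]) h2
  refine ⟨hne, ?_⟩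
  have hφ := (memLp_two_iff_integrable_sq_norm (Lp.aestronglyMeasurable φ)).1 (Lp.memLp φ)
  have hu : Integrable (fun x => u (φ x)) haarAddCircle := by
    refine ⟨(humeas.comp_aemeasurable (Lp.aestronglyMeasurable φ).aemeasurable).aestronglyMeasurable,
      ?_⟩
    rw [hasFiniteIntegral_iff_ofReal (Eventually.of_forall fun x => hu0 _)]
    refine lt_of_le_of_lt (le_of_eq ?_) (hfatou.trans_lt ENNReal.ofReal_lt_top)
    refine lintegral_congr_ae ?_
    filter_upwards [hne, hconv] with x hx ⟨hx1, hx2⟩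
    refine (Tendsto.liminf_eq ?_).symm
    refine ENNReal.tendsto_ofReal ?_
    exact (hx2.norm.pow 2).sub (hx2.norm.log (norm_ne_zero_iff.2 hx))
  refine (hφ.sub hu).congr (Eventually.of_forall fun x => ?_)
  simp [u]

end

section

/-! The spectral density of a nonzero vector with trivial remote space. -/

open AddCircle Polynomial

/-- Multiplication by the character `fourier n` on `L²` of the circle. -/
def fourierMul (n : ℤ) : Lp ℂ 2 (haarAddCircle (T := 2 * Real.pi)) →L[ℂ]
    Lp ℂ 2 (haarAddCircle (T := 2 * Real.pi)) :=
  (ContinuousLinearMap.mul ℂ ℂ).holderL haarAddCircle ⊤ 2 2 (fourierLp ⊤ n)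

lemma coeFn_fourierMul (n : ℤ) (φ : Lp ℂ 2 (haarAddCircle (T := 2 * Real.pi))) :
    fourierMul n φ =ᵐ[haarAddCircle] fun x => fourier n x * φ x := by
  filter_upwards [(ContinuousLinearMap.mul ℂ ℂ).coeFn_holder (r := 2) (fourierLp ⊤ n) φ,
    coeFn_fourierLp (T := 2 * Real.pi) ⊤ n] with x h1 h2
  refine h1.trans ?_
  rw [h2, ContinuousLinearMap.mul_apply']

lemma fourierMul_fourierLp (n m : ℤ) :
    fourierMul n (fourierLp 2 m) = fourierLp (T := 2 * Real.pi) 2 (n + m) := by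
  refine Lp.ext ?_
  filter_upwards [coeFn_fourierMul n (fourierLp 2 m), coeFn_fourierLp (T := 2 * Real.pi) 2 m,
    coeFn_fourierLp (T := 2 * Real.pi) 2 (n + m)] with x h1 h2 h3
  rw [h1, h2, h3, fourier_add]

lemma inner_fourierMul (n : ℤ) (φ : Lp ℂ 2 (haarAddCircle (T := 2 * Real.pi))) :
    inner ℂ φ (fourierMul n φ) = ∫ x, fourier n x * (‖φ x‖ ^ 2 : ℝ) ∂haarAddCircle := by
  rw [L2.inner_def]
  refine integral_congr_ae ?_
  filter_upwards [coeFn_fourierMul n φ] with x hx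
  rw [hx, RCLike.inner_apply, mul_assoc, Complex.mul_conj']
  simp

/-- A nonzero vector with trivial remote space has a log-integrable spectral density. -/
theorem Wold.exists_spectral_density {H : Type*} [NormedAddCommGroup H] [InnerProductSpace ℂ H]
    [CompleteSpace H] (U : H →ₗᵢ[ℂ] H) (f : H) (hf : f ≠ 0) (h : Wold.remote U f = ⊥) :
    ∃ φ : Lp ℂ 2 (haarAddCircle (T := 2 * Real.pi)),
      (∀ᵐ x ∂haarAddCircle, φ x ≠ 0) ∧ Integrable (fun x => Real.log ‖φ x‖) haarAddCircle ∧
      ∀ n : ℕ, inner ℂ f (U^[n] f) =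
        ∫ x, fourier (-(n : ℤ)) x * (‖φ x‖ ^ 2 : ℝ) ∂haarAddCircle := by
  obtain ⟨e, he, he0, hlim⟩ := Wold.exists_innovation U f hf h
  set a : ℕ → ℂ := fun k => inner ℂ (U^[k] e) f with ha
  have hb : Orthonormal ℂ (fun k : ℕ => fourierLp (T := 2 * Real.pi) 2 (k : ℤ)) :=
    orthonormal_fourier.comp _ Nat.cast_injective
  -- The conjugates match the sign in $e^{-int}$: both sides become $\sum_j a_j\overline{a_{n+j}}$.
  have hsum : Summable fun k => conj (a k) • fourierLp (T := 2 * Real.pi) 2 (k : ℤ) := by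
    refine (hb.orthogonalFamily.summable_iff_norm_sq_summable fun k => conj (a k)).2 ?_
    simpa using he.inner_products_summable (x := f)
  obtain ⟨φ, hφ⟩ := hsum
  have hφ' := hφ.tendsto_sum_nat
  -- With `n + 1` terms the constant coefficient is present even at $n=0$.
  let q : ℕ → ℂ[X] := fun n => ∑ k ∈ Finset.range (n + 1), monomial k (conj (a k))
  have hq : ∀ n, ContinuousMap.toLp 2 haarAddCircle ℂ (q n).toAddCircle =
      ∑ k ∈ Finset.range (n + 1), conj (a k) • fourierLp (T := 2 * Real.pi) 2 (k : ℤ) := by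
    intro n
    simp only [q, map_sum, toAddCircle_monomial_eq_smul_fourier, map_smul]
  have hlog := log_integrable_of_tendsto_toLp (q := q) (c := conj (a 0)) (φ := φ)
    ((_root_.map_ne_zero _).2 he0)
    (fun n => by simp [q, coeff_monomial])
    (by simp only [hq]; exact hφ'.comp (tendsto_add_atTop_nat 1))
  refine ⟨φ, hlog.1, hlog.2, fun n => ?_⟩
  rw [← inner_fourierMul]
  have h1 : Tendsto (fun m => inner ℂ (∑ k ∈ Finset.range m, a k • U^[k] e)
      ((U ^ n) (∑ k ∈ Finset.range m, a k • U^[k] e))) atTop (𝓝 (inner ℂ f (U^[n] f))) := by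
    rw [← LinearIsometry.coe_pow]
    exact hlim.inner (((U ^ n).continuous.tendsto f).comp hlim)
  have h2 : Tendsto (fun m => inner ℂ
      (∑ k ∈ Finset.range m, conj (a k) • fourierLp (T := 2 * Real.pi) 2 (k : ℤ))
      (fourierMul (-(n : ℤ))
        (∑ k ∈ Finset.range m, conj (a k) • fourierLp (T := 2 * Real.pi) 2 (k : ℤ)))) atTop
      (𝓝 (inner ℂ φ (fourierMul (-(n : ℤ)) φ))) :=
    hφ'.inner (((fourierMul (-(n : ℤ))).continuous.tendsto φ).comp hφ')
  refine tendsto_nhds_unique (h1.congr fun m => ?_) h2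
  simp only [map_sum, map_smul, sum_inner, inner_sum, inner_smul_left, inner_smul_right,
    fourierMul_fourierLp, LinearIsometry.coe_pow, ← Function.iterate_add_apply, Finset.mul_sum]
  rw [Finset.sum_comm]
  refine Finset.sum_congr rfl fun i _ => Finset.sum_congr rfl fun j _ => ?_
  have e1 := (orthonormal_iff_ite.1 he) i (n + j)
  have e2 := (orthonormal_iff_ite.1 (orthonormal_fourier (T := 2 * Real.pi))) (j : ℤ)
    (-(n : ℤ) + i)
  rw [e1, e2]
  have : (i = n + j) ↔ ((j : ℤ) = -(n : ℤ) + i) := by omega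
  simp only [this, Complex.conj_conj]
  ring

end

section

/-! Uniqueness and regularity of the spectral measure. -/

open AddCircle

lemma integral_conj_fourier (σ : Measure (AddCircle (2 * Real.pi))) (k : ℤ) :
    ∫ x, fourier (-k) x ∂σ = conj (∫ x, fourier k x ∂σ) := by
  rw [← integral_conj]
  simp only [fourier_neg]

/-- A finite measure on the circle is determined by its Fourier coefficients. -/
lemma measure_eq_of_integral_fourier {σ τ : Measure (AddCircle (2 * Real.pi))}
    [IsFiniteMeasure σ] [IsFiniteMeasure τ]
    (h : ∀ k : ℕ, ∫ x, fourier (-(k : ℤ)) x ∂σ = ∫ x, fourier (-(k : ℤ)) x ∂τ) : σ = τ := by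
  have hall : ∀ k : ℤ, ∫ x, fourier k x ∂σ = ∫ x, fourier k x ∂τ := by
    intro k
    obtain ⟨n, rfl | rfl⟩ := k.eq_nat_or_neg
    · have := h n
      rw [integral_conj_fourier, integral_conj_fourier] at this
      exact (starRingEnd ℂ).injective this
    · exact h n
  have hint : ∀ (ν : Measure (AddCircle (2 * Real.pi))) [IsFiniteMeasure ν]
      (g : C(AddCircle (2 * Real.pi), ℂ)), Integrable g ν := fun ν _ g =>
    g.continuous.integrable_of_hasCompactSupport (HasCompactSupport.of_compactSpace _)
  have hcont : ∀ (ν : Measure (AddCircle (2 * Real.pi))) [IsFiniteMeasure ν],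
      Continuous fun g : C(AddCircle (2 * Real.pi), ℂ) => ∫ x, g x ∂ν := by
    intro ν _
    have := (continuous_integral (μ := ν) (G := ℂ)).comp (ContinuousMap.toLp 1 ν ℂ).continuous
    refine this.congr fun g => ?_
    exact (integral_congr_ae (ContinuousMap.coeFn_toLp ν g))
  have hC : ∀ g : C(AddCircle (2 * Real.pi), ℂ), ∫ x, g x ∂σ = ∫ x, g x ∂τ := by
    intro g
    -- Trigonometric polynomials are uniformly dense, and both integrals are continuous in $g$.
    have hg : g ∈ (Submodule.span ℂ (Set.range (@fourier (2 * Real.pi)))).topologicalClosure := by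
      rw [span_fourier_closure_eq_top]; trivial
    have hcl : IsClosed {g : C(AddCircle (2 * Real.pi), ℂ) | ∫ x, g x ∂σ = ∫ x, g x ∂τ} :=
      isClosed_eq (hcont σ) (hcont τ)
    refine closure_minimal (fun g hg => ?_) hcl hg
    induction hg using Submodule.span_induction with
    | mem g hg => obtain ⟨k, rfl⟩ := hg; exact hall k
    | zero => simp
    | add g₁ g₂ _ _ h₁ h₂ =>
      simp only [Set.mem_ofPred_eq, ContinuousMap.add_apply] at h₁ h₂ ⊢
      rw [integral_add (hint σ _) (hint σ _), integral_add (hint τ _) (hint τ _), h₁, h₂]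
    | smul c g _ h₁ =>
      simp only [Set.mem_ofPred_eq, ContinuousMap.smul_apply] at h₁ ⊢
      rw [integral_smul, integral_smul, h₁]
  refine ext_of_forall_integral_eq_of_IsFiniteMeasure fun g => ?_
  have := hC ⟨fun x => (g x : ℂ), Complex.continuous_ofReal.comp g.continuous⟩
  simp only [ContinuousMap.coe_mk, integral_complex_ofReal] at this
  exact_mod_cast this

/-- The measure with density `‖φ‖²` with respect to normalized Lebesgue measure. -/
def normSqMeasure (φ : Lp ℂ 2 (haarAddCircle (T := 2 * Real.pi))) :
    Measure (AddCircle (2 * Real.pi)) :=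
  haarAddCircle.withDensity fun x => ENNReal.ofReal (‖φ x‖ ^ 2)

variable (φ : Lp ℂ 2 (haarAddCircle (T := 2 * Real.pi)))

lemma aemeasurable_ofReal_normSq :
    AEMeasurable (fun x => ENNReal.ofReal (‖φ x‖ ^ 2)) haarAddCircle :=
  ((Lp.aestronglyMeasurable φ).norm.aemeasurable.pow_const 2).ennreal_ofReal

instance : IsFiniteMeasure (normSqMeasure φ) := by
  have h := (memLp_two_iff_integrable_sq_norm (Lp.aestronglyMeasurable φ)).1 (Lp.memLp φ)
  refine isFiniteMeasure_withDensity_ofReal h.2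

lemma integral_normSqMeasure (g : AddCircle (2 * Real.pi) → ℂ) :
    ∫ x, g x ∂(normSqMeasure φ) = ∫ x, g x * (‖φ x‖ ^ 2 : ℝ) ∂haarAddCircle := by
  rw [normSqMeasure, integral_withDensity_eq_integral_toReal_smul₀ (aemeasurable_ofReal_normSq φ)
    (Eventually.of_forall fun x => ENNReal.ofReal_lt_top)]
  refine integral_congr_ae (Eventually.of_forall fun x => ?_)
  simp only [ENNReal.toReal_ofReal (sq_nonneg _), Complex.real_smul]
  rw [mul_comm]

lemma haarAddCircle_eq_smul_volume : (haarAddCircle : Measure (AddCircle (2 * Real.pi))) =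
    (ENNReal.ofReal (2 * Real.pi))⁻¹ • volume := by
  rw [volume_eq_smul_haarAddCircle, smul_smul, ENNReal.inv_mul_cancel _ ENNReal.ofReal_ne_top,
    one_smul]
  simp [Real.pi_pos]

lemma normSqMeasure_absolutelyContinuous : normSqMeasure φ ≪ volume :=
  (withDensity_absolutelyContinuous _ _).trans <| by
    rw [haarAddCircle_eq_smul_volume]
    exact Measure.smul_absolutelyContinuous

/-- The density with respect to Lebesgue measure is $|\varphi|^2/2\pi$, whose logarithm is a
constant plus $2\log|\varphi|$. -/
lemma logIntegrable_rnDeriv_normSqMeasure (h0 : ∀ᵐ x ∂haarAddCircle, φ x ≠ 0)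
    (hlog : Integrable (fun x => Real.log ‖φ x‖) haarAddCircle) :
    LogIntegrable ((normSqMeasure φ).rnDeriv volume) volume := by
  set c : ENNReal := (ENNReal.ofReal (2 * Real.pi))⁻¹ with hc
  have hc0 : c ≠ 0 := ENNReal.inv_ne_zero.2 ENNReal.ofReal_ne_top
  have hct : c ≠ ⊤ := ENNReal.inv_ne_top.2 (by simp [Real.pi_pos])
  have hvol : (volume : Measure (AddCircle (2 * Real.pi))) ≪ haarAddCircle := by
    rw [volume_eq_smul_haarAddCircle]
    exact Measure.smul_absolutelyContinuous
  have hm : AEMeasurable (fun x => ENNReal.ofReal (‖φ x‖ ^ 2))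
      (volume : Measure (AddCircle (2 * Real.pi))) :=
    (aemeasurable_ofReal_normSq φ).mono_ac hvol
  have hder : (normSqMeasure φ).rnDeriv volume =ᵐ[volume]
      fun x => c * ENNReal.ofReal (‖φ x‖ ^ 2) := by
    have (g : AddCircle (2 * Real.pi) → ENNReal) :
        haarAddCircle.withDensity g = volume.withDensity (c • g) := by
      rw [haarAddCircle_eq_smul_volume, withDensity_smul_measure, withDensity_smul' _ _ hct]
    rw [normSqMeasure, this]
    exact Measure.rnDeriv_withDensity₀ _ (hm.const_mul c)
  have h0' := hvol.ae_le h0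
  refine ⟨?_, ?_⟩
  · filter_upwards [hder, h0'] with x hx hx0
    rw [hx]
    have : 0 < ‖φ x‖ := norm_pos_iff.2 hx0
    exact ENNReal.mul_pos hc0 (ENNReal.ofReal_pos.2 (by positivity)).ne'
  · have hint : Integrable (fun x => Real.log ‖φ x‖)
        (volume : Measure (AddCircle (2 * Real.pi))) := by
      rw [volume_eq_smul_haarAddCircle]
      exact hlog.smul_measure ENNReal.ofReal_ne_top
    refine ((integrable_const (Real.log c.toReal)).add (hint.const_mul 2)).congr ?_
    filter_upwards [hder, h0'] with x hx hx0
    have : ‖φ x‖ ≠ 0 := norm_ne_zero_iff.2 hx0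
    rw [hx, ENNReal.toReal_mul, ENNReal.toReal_ofReal (sq_nonneg _),
      Real.log_mul (ENNReal.toReal_ne_zero.2 ⟨hc0, hct⟩) (pow_ne_zero 2 this), Real.log_pow]
    simp

end

section

/-! Koopman operator of a measure with a generic point. -/

section Koopman

variable {X : Type*} [TopologicalSpace X] [CompactSpace X] [MeasurableSpace X]

lemma tendsto_inv_mul_of_bounded {N : ℕ → ℕ} (hN : Tendsto N atTop atTop) {c : ℕ → ℂ} {C : ℝ}
    (hc : ∀ j, ‖c j‖ ≤ C) : Tendsto (fun j => (N j : ℂ)⁻¹ * c j) atTop (𝓝 0) := by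
  refine squeeze_zero_norm (a := fun j => (N j : ℝ)⁻¹ * C) (fun j => ?_) ?_
  · rw [norm_mul, norm_inv, Complex.norm_natCast]
    gcongr
    exact hc j
  · simpa using ((tendsto_inv_atTop_nhds_zero_nat (𝕜 := ℝ)).comp hN).mul_const C

variable {T : C(X, X)} {P : Measure X} {N : ℕ → ℕ} {w : X}

/-- The orbit averages of $f\circ T$ and $f$ differ by the telescoped term $(f(T^{N_j}w)-f(w))/N_j$.
-/
lemma IsGenericAlong.integral_comp (hN : Tendsto N atTop atTop) (hw : IsGenericAlong T P N w)
    (f : C(X, ℂ)) : ∫ x, f (T x) ∂P = ∫ x, f x ∂P := by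
  have h1 := hw (f.comp T)
  have h2 := tendsto_inv_mul_of_bounded hN (c := fun j => f (T^[N j] w) - f w) (C := ‖f‖ + ‖f‖)
    fun j => (norm_sub_le _ _).trans (add_le_add (f.norm_coe_le_norm _) (f.norm_coe_le_norm _))
  refine tendsto_nhds_unique h1 ((((hw f).add h2).congr fun j => ?_).trans_eq ?_)
  · have h3 := Finset.sum_range_sub (fun n => f (T^[n] w)) (N j)
    simp only [Function.iterate_zero, id_eq] at h3
    rw [← mul_add, ← h3, ← Finset.sum_add_distrib]
    simp [Function.iterate_succ_apply']
  · rw [add_zero]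

variable [BorelSpace X]

lemma IsGenericAlong.measurePreserving [HasOuterApproxClosed X] [IsFiniteMeasure P]
    (hN : Tendsto N atTop atTop) (hw : IsGenericAlong T P N w) : MeasurePreserving T P P := by
  refine ⟨T.continuous.measurable, ?_⟩
  refine ext_of_forall_integral_eq_of_IsFiniteMeasure fun g => ?_
  rw [integral_map T.continuous.aemeasurable g.continuous.aestronglyMeasurable]
  have := hw.integral_comp hN ⟨fun x => (g x : ℂ), Complex.continuous_ofReal.comp g.continuous⟩
  simp only [ContinuousMap.coe_mk, integral_complex_ofReal] at this
  exact_mod_cast this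

variable [IsFiniteMeasure P]

/-- The Koopman operator `g ↦ g ∘ T` on `L²(P)`. -/
def koopman (hT : MeasurePreserving T P P) : Lp ℂ 2 P →ₗᵢ[ℂ] Lp ℂ 2 P :=
  Lp.compMeasurePreservingₗᵢ ℂ T hT

lemma koopman_iterate_toLp (hT : MeasurePreserving T P P) (f : C(X, ℂ)) (n : ℕ) :
    (koopman hT)^[n] (ContinuousMap.toLp 2 P ℂ f) =
      ContinuousMap.toLp 2 P ℂ (dynProcess T f n) := by
  induction n with
  | zero => rfl
  | succ n ih =>
    rw [Function.iterate_succ_apply', ih]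
    rfl

lemma tailSpace_eq_tail (hT : MeasurePreserving T P P) (f : C(X, ℂ)) (n : ℕ) :
    tailSpace T P f n = Wold.tail (koopman hT) (ContinuousMap.toLp 2 P ℂ f) n := by
  simp only [tailSpace, Wold.tail, koopman_iterate_toLp]

lemma remoteSpace_eq_remote (hT : MeasurePreserving T P P) (f : C(X, ℂ)) :
    remoteSpace T P f = Wold.remote (koopman hT) (ContinuousMap.toLp 2 P ℂ f) :=
  iInf_congr fun n => tailSpace_eq_tail hT f n

lemma remoteCondExp_eq_starProjection (hT : MeasurePreserving T P P) (f : C(X, ℂ)) :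
    remoteCondExp T P f =
      (Wold.remote (koopman hT) (ContinuousMap.toLp 2 P ℂ f)).starProjection := by
  simp only [remoteCondExp, remoteSpace_eq_remote hT f]

end Koopman

/-! Squarefree numbers have positive lower density. -/

/-- Telescoping with $1/d^2\le 1/(d-1)-1/d$ for $d\ge3$. The term $d=2$ is kept exact, which brings
the bound below $1$. -/
lemma sum_inv_sq_le (k : ℕ) :
    ∑ d ∈ Finset.Ico 2 (k + 3), ((d : ℝ) ^ 2)⁻¹ ≤ 3 / 4 - ((k : ℝ) + 2)⁻¹ := by
  induction k with
  | zero => norm_num [Finset.sum_Ico_succ_top]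
  | succ k ih =>
    rw [Finset.sum_Ico_succ_top (by omega)]
    have h : (((k + 3 : ℕ) : ℝ) ^ 2)⁻¹ ≤ ((k : ℝ) + 2)⁻¹ - (((k + 1 : ℕ) : ℝ) + 2)⁻¹ := by
      push_cast
      have hk : (0 : ℝ) ≤ k := k.cast_nonneg
      rw [inv_sub_inv (by positivity) (by positivity), inv_eq_one_div,
        div_le_div_iff₀ (by positivity) (by positivity)]
      nlinarith
    linarith

lemma card_not_squarefree_le (M : ℕ) :
    (((Finset.Ioc 0 M).filter fun n => ¬ Squarefree n).card : ℝ) ≤ 3 / 4 * M := by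
  -- Union bound over square divisors. Any range containing all $d\ge2$ with $d^2\le M$ would do;
  -- this one fits `sum_inv_sq_le`.
  have hsub : ((Finset.Ioc 0 M).filter fun n => ¬ Squarefree n) ⊆
      (Finset.Ico 2 (M + 3)).biUnion fun d => (Finset.Ioc 0 M).filter fun n => d ^ 2 ∣ n := by
    intro n hn
    rw [Finset.mem_filter, Finset.mem_Ioc] at hn
    obtain ⟨⟨hn0, hnM⟩, hsq⟩ := hn
    simp only [Squarefree, not_forall, Nat.isUnit_iff] at hsq
    obtain ⟨d, hd, hd1⟩ := hsq
    have hdn := Nat.le_of_dvd hn0 hd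
    have hd0 : d ≠ 0 := by rintro rfl; simp at hd; omega
    simp only [Finset.mem_biUnion, Finset.mem_Ico, Finset.mem_filter, Finset.mem_Ioc]
    exact ⟨d, ⟨by omega, by nlinarith⟩, ⟨hn0, hnM⟩, by rwa [sq]⟩
  have h1 := (Finset.card_le_card hsub).trans Finset.card_biUnion_le
  have h2 : (((Finset.Ioc 0 M).filter fun n => ¬ Squarefree n).card : ℝ) ≤
      ∑ d ∈ Finset.Ico 2 (M + 3), (M : ℝ) * ((d : ℝ) ^ 2)⁻¹ := by
    refine (Nat.cast_le.2 h1).trans ?_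
    push_cast
    refine Finset.sum_le_sum fun d _ => ?_
    rw [Nat.Ioc_filter_dvd_card_eq_div, ← div_eq_mul_inv]
    exact_mod_cast Nat.cast_div_le (α := ℝ) (m := M) (n := d ^ 2)
  rw [← Finset.mul_sum] at h2
  have h3 := sum_inv_sq_le M
  have h4 : (0 : ℝ) ≤ ((M : ℝ) + 2)⁻¹ := by positivity
  have h5 : (0 : ℝ) ≤ M := M.cast_nonneg
  nlinarith

lemma le_sum_moebius_sq (M : ℕ) :
    (1 / 4 : ℝ) * M ≤ ∑ n ∈ Finset.range (M + 1), (ArithmeticFunction.moebius n : ℝ) ^ 2 := by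
  have h1 := card_not_squarefree_le M
  have h2 : (((Finset.Ioc 0 M).filter Squarefree).card : ℝ) +
      ((Finset.Ioc 0 M).filter fun n => ¬ Squarefree n).card = M := by
    exact_mod_cast (Finset.card_filter_add_card_filter_not (s := Finset.Ioc 0 M) Squarefree).trans
      (by simp)
  have h3 : (((Finset.Ioc 0 M).filter Squarefree).card : ℝ) ≤
      ∑ n ∈ Finset.range (M + 1), (ArithmeticFunction.moebius n : ℝ) ^ 2 := by
    rw [Finset.card_eq_sum_ones, Nat.cast_sum]
    have hsub : (Finset.Ioc 0 M).filter Squarefree ⊆ Finset.range (M + 1) := by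
      intro n hn
      simp only [Finset.mem_filter, Finset.mem_Ioc] at hn
      simp only [Finset.mem_range]
      omega
    refine le_trans (Finset.sum_le_sum fun n hn => ?_)
      (Finset.sum_le_sum_of_subset_of_nonneg hsub fun _ _ _ => sq_nonneg _)
    have := ArithmeticFunction.moebius_sq_eq_one_of_squarefree (Finset.mem_filter.1 hn).2
    exact_mod_cast this.ge
  linarith

end

/-! The Möbius flow. -/

lemma mobiusShift_iterate_coe (n : ℕ) (y : MobiusFlow) :
    (mobiusShift^[n] y).1 = seqShift^[n] y.1 := by
  induction n generalizing y with
  | zero => rfl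
  | succ n ih => rw [Function.iterate_succ_apply, ih, Function.iterate_succ_apply]; rfl

lemma mobiusCoord_iterate (n : ℕ) :
    mobiusCoord (mobiusShift^[n] mobiusPoint) = (ArithmeticFunction.moebius n : ℂ) := by
  change (((mobiusShift^[n] mobiusPoint).1 0 : ℤ) : ℂ) = _
  rw [mobiusShift_iterate_coe, seqShift_iterate, zero_add]
  rfl

lemma conj_mobiusCoord (y : MobiusFlow) : conj (mobiusCoord y) = mobiusCoord y :=
  map_intCast (starRingEnd ℂ) _

variable {N : ℕ → ℕ} {P : Measure MobiusFlow} [IsProbabilityMeasure P]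

lemma tendsto_inner_mobiusCoord (hgen : IsGenericAlong mobiusShift P N mobiusPoint)
    (h : C(MobiusFlow, ℂ)) :
    Tendsto (fun j => (N j : ℂ)⁻¹ * ∑ n ∈ Finset.range (N j),
        h (mobiusShift^[n] mobiusPoint) * (ArithmeticFunction.moebius n : ℂ)) atTop
      (𝓝 (inner ℂ (ContinuousMap.toLp 2 P ℂ mobiusCoord) (ContinuousMap.toLp 2 P ℂ h))) := by
  have := hgen (h * mobiusCoord)
  simp only [ContinuousMap.mul_apply, mobiusCoord_iterate] at this
  rw [ContinuousMap.inner_toLp]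
  simpa only [conj_mobiusCoord] using this

lemma inner_mobiusCoord_eq_zero (hN : Tendsto N atTop atTop)
    (hgen : IsGenericAlong mobiusShift P N mobiusPoint)
    (horth : MobiusOrthogonalToSingular mobiusShift P N) {h : C(MobiusFlow, ℂ)}
    (hs : IsSingularProcess mobiusShift P h) :
    inner ℂ (ContinuousMap.toLp 2 P ℂ mobiusCoord) (ContinuousMap.toLp 2 P ℂ h) = 0 := by
  have h1 := horth h hs mobiusPoint hgen
  refine tendsto_nhds_unique (tendsto_inner_mobiusCoord hgen h) ?_
  let b : ℕ → ℂ := fun n => h (mobiusShift^[n] mobiusPoint) * (ArithmeticFunction.moebius n : ℂ)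
  have hb : ∀ n, ‖b n‖ ≤ ‖h‖ := by
    intro n
    have h3 : ‖(ArithmeticFunction.moebius n : ℂ)‖ ≤ 1 := by
      rw [Complex.norm_intCast]
      exact_mod_cast ArithmeticFunction.abs_moebius_le_one
    rw [norm_mul]
    exact (mul_le_mul (h.norm_coe_le_norm _) h3 (norm_nonneg _) (norm_nonneg _)).trans_eq
      (mul_one _)
  -- Hypothesis (i) sums over $1,\dots,N_j$ and genericity over $0,\dots,N_j-1$. The term at $0$
  -- vanishes as $\mu(0)=0$, and the one at $N_j$ disappears after division by $N_j$.
  have h2 := tendsto_inv_mul_of_bounded hN (c := fun j => b (N j)) fun j => hb (N j)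
  have h3 := h1.sub h2
  rw [sub_zero] at h3
  refine h3.congr fun j => ?_
  have hb0 : b 0 = 0 := by simp [b]
  have e1 : ∑ n ∈ Finset.Icc 1 (N j), b n = ∑ n ∈ Finset.range (N j), b n + b (N j) := by
    rw [← Finset.sum_range_succ, Finset.sum_range_eq_add_Ico _ (Nat.succ_pos _), hb0, zero_add]
    rfl
  change (N j : ℂ)⁻¹ * ∑ n ∈ Finset.Icc 1 (N j), b n - (N j : ℂ)⁻¹ * b (N j) = _
  rw [e1, ← mul_sub, add_sub_cancel_right]

/-- $\|f_0\|^2$ is the limit of the averages of $\mu^2$, hence at least $1/4$. -/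
lemma toLp_mobiusCoord_ne_zero (hN : Tendsto N atTop atTop)
    (hgen : IsGenericAlong mobiusShift P N mobiusPoint) :
    ContinuousMap.toLp 2 P ℂ mobiusCoord ≠ 0 := by
  intro h0
  have h1 := tendsto_inner_mobiusCoord hgen mobiusCoord
  rw [h0, inner_zero_left] at h1
  have h2 := (Complex.continuous_re.tendsto 0).comp h1
  have hlow : ∀ᶠ j in atTop, (1 / 4 : ℝ) - 1 / 4 * (N j : ℝ)⁻¹ ≤
      (Complex.re ∘ fun j => (N j : ℂ)⁻¹ * ∑ n ∈ Finset.range (N j),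
        mobiusCoord (mobiusShift^[n] mobiusPoint) * (ArithmeticFunction.moebius n : ℂ)) j := by
    filter_upwards [hN.eventually_ge_atTop 1] with j hj
    obtain ⟨M, hM⟩ := Nat.exists_eq_add_of_le' hj
    have hcast : (N j : ℂ)⁻¹ * ∑ n ∈ Finset.range (N j),
        mobiusCoord (mobiusShift^[n] mobiusPoint) * (ArithmeticFunction.moebius n : ℂ) =
        (((N j : ℝ)⁻¹ * ∑ n ∈ Finset.range (N j),
          (ArithmeticFunction.moebius n : ℝ) ^ 2 : ℝ) : ℂ) := by
      push_cast
      simp only [mobiusCoord_iterate, sq]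
    rw [Function.comp_apply, hcast, Complex.ofReal_re, hM]
    have hle := le_sum_moebius_sq M
    have hpos : (0 : ℝ) < ((M + 1 : ℕ) : ℝ) := by positivity
    have hmul := mul_le_mul_of_nonneg_left hle (inv_nonneg.2 hpos.le)
    refine le_trans (le_of_eq ?_) hmul
    field_simp
    push_cast
    ring
  have h3 : Tendsto (fun j => (1 / 4 : ℝ) - 1 / 4 * (N j : ℝ)⁻¹) atTop
      (𝓝 (1 / 4 - 1 / 4 * 0)) :=
    (((tendsto_inv_atTop_nhds_zero_nat (𝕜 := ℝ)).comp hN).const_mul _).const_sub _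
  have h4 := le_of_tendsto_of_tendsto h3 h2 hlow
  norm_num at h4

/-- Continuity of the singular part of $f_0$ is what allows orthogonality to singular processes,
assumed only for continuous functions, to be applied to it. -/
theorem remote_mobiusCoord_eq_bot (hN : Tendsto N atTop atTop)
    (hgen : IsGenericAlong mobiusShift P N mobiusPoint)
    (horth : MobiusOrthogonalToSingular mobiusShift P N)
    (hcont : CondExpPreservesContinuous mobiusShift P mobiusCoord)
    (hT : MeasurePreserving mobiusShift P P) :
    Wold.remote (koopman hT) (ContinuousMap.toLp 2 P ℂ mobiusCoord) = ⊥ := by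
  obtain ⟨h, hh⟩ := hcont mobiusCoord
  rw [remoteCondExp_eq_starProjection hT] at hh
  refine Wold.remote_eq_bot_of_inner_eq_zero _ _ ?_
  rw [hh]
  refine inner_mobiusCoord_eq_zero hN hgen horth ?_
  rw [IsSingularProcess, remoteSpace_eq_remote hT, ← hh]
  exact Wold.starProjection_mem_remote _ _

lemma tendsto_moebius_correlation (hgen : IsGenericAlong mobiusShift P N mobiusPoint)
    (hT : MeasurePreserving mobiusShift P P) (k : ℕ) :
    Tendsto (fun j => (N j : ℂ)⁻¹ * ∑ n ∈ Finset.range (N j),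
        (ArithmeticFunction.moebius (n + k) : ℂ) * conj (ArithmeticFunction.moebius n : ℂ)) atTop
      (𝓝 (inner ℂ (ContinuousMap.toLp 2 P ℂ mobiusCoord)
        ((koopman hT)^[k] (ContinuousMap.toLp 2 P ℂ mobiusCoord)))) := by
  rw [koopman_iterate_toLp]
  refine (tendsto_inner_mobiusCoord hgen _).congr fun j => ?_
  refine congrArg _ (Finset.sum_congr rfl fun n _ => ?_)
  change mobiusCoord (mobiusShift^[k] (mobiusShift^[n] mobiusPoint)) * _ = _
  rw [← Function.iterate_add_apply, mobiusCoord_iterate, map_intCast (starRingEnd ℂ), add_comm k n]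

end

theorem theorem1 (N : ℕ → ℕ) (hN : Tendsto N atTop atTop)
    (P : Measure MobiusFlow) [IsProbabilityMeasure P]
    (hgen : IsGenericAlong mobiusShift P N mobiusPoint)
    (horth : MobiusOrthogonalToSingular mobiusShift P N)
    (hcont : CondExpPreservesContinuous mobiusShift P mobiusCoord) :
    (∃ σ : Measure (AddCircle (2 * Real.pi)),
      IsSpectralMeasureAlong N (fun n => (ArithmeticFunction.moebius n : ℂ)) σ) ∧
    ∀ σ : Measure (AddCircle (2 * Real.pi)),
      IsSpectralMeasureAlong N (fun n => (ArithmeticFunction.moebius n : ℂ)) σ →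
        σ ≪ volume ∧ LogIntegrable (σ.rnDeriv volume) volume := by
  have hT := hgen.measurePreserving hN
  obtain ⟨φ, h0, hlog, hφ⟩ := Wold.exists_spectral_density (koopman hT) _
    (toLp_mobiusCoord_ne_zero hN hgen) (remote_mobiusCoord_eq_bot hN hgen horth hcont hT)
  have hspec : IsSpectralMeasureAlong N (fun n => (ArithmeticFunction.moebius n : ℂ))
      (normSqMeasure φ) := by
    refine ⟨inferInstance, fun k => ?_⟩
    rw [integral_normSqMeasure, ← hφ k]
    exact tendsto_moebius_correlation hgen hT k
  refine ⟨⟨_, hspec⟩, fun σ hσ => ?_⟩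
  have := hσ.1
  have hσφ : σ = normSqMeasure φ :=
    measure_eq_of_integral_fourier fun k => tendsto_nhds_unique (hσ.2 k) (hspec.2 k)
  rw [hσφ]
  exact ⟨normSqMeasure_absolutelyContinuous φ, logIntegrable_rnDeriv_normSqMeasure φ h0 hlog⟩
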